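/- Let $E$ be a nonzero real Banach space with dual $E^*$ and bidual $E^{**}$, and for $x\in E$ let $\widehat x\in E^{**}$ be its canonical image. Write $\langle x,x^*\rangle = x^*(x)$ for $(x,x^*)\in E\times E^*$ and $\langle x^*,x^{**}\rangle = x^{**}(x^*)$ for $(x^*,x^{**})\in E^*\times E^{**}$. For a multifunction $S\colon E\rightrightarrows E^*$, let $G(S)=\{(s,s^*)\in E\times E^*: s^*\in S(s)\}$ be its graph and $R(S)=\bigcup_{x\in E}S(x)$ its range. $S$ is monotone if $\langle s-t,s^*-t^*\rangle\ge 0$ for all $(s,s^*),(t,t^*)\in G(S)$, and maximally monotone if it is monotone and $G(S)$ is not properly contained in the graph of another monotone multifunction. Infima are taken in $[-\infty,\infty]$. **Theorem.** Let $S\colon E\rightrightarrows E^*$ be maximally monotone. Then the following three conditions are equivalent. (a) $S$ is quasidense: for all $(x,x^*)\in E\times E^*$, $$\inf_{(s,s^*)\in G(S)}\Big[\tfrac12\|s-x\|^2+\tfrac12\|s^*-x^*\|^2+\langle s-x,s^*-x^*\rangle\Big]\le 0.$$ (b) $S$ is of type (FP) (locally maximally monotone): $S$ is monotone and, whenever $U$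 is a convex (norm-)open subset of $E^*$ with $U\cap R(S)\ne\emptyset$, $(w,w^*)\in E\times U$, and $\langle s-w,s^*-w^*\rangle\ge 0$ for all $(s,s^*)\in G(S)$ with $s^*\in U$, then $(w,w^*)\in G(S)$. (c) $S$ is of type (NI): for all $(w^*,w^{**})\in E^*\times E^{**}$, $$\inf_{(s,s^*)\in G(S)}\langle s^*-w^*,\widehat s-w^{**}\rangle\le 0.$$ -/

import Mathlib

namespace Multifunction

variable {E : Type*} [NormedAddCommGroup E] [NormedSpace ℝ E]

/-- The graph `G(S)` of a multifunction `S : E ⇉ E*`. -/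
def graph (S : E → Set (StrongDual ℝ E)) : Set (E × StrongDual ℝ E) :=
  {p | p.2 ∈ S p.1}

/-- The range `R(S)` of a multifunction `S : E ⇉ E*`. -/
def range (S : E → Set (StrongDual ℝ E)) : Set (StrongDual ℝ E) :=
  ⋃ x, S x

/-- `S` is monotone: `⟨s - t, s* - t*⟩ ≥ 0` for all `(s, s*), (t, t*) ∈ G(S)`. -/
def IsMonotone (S : E → Set (StrongDual ℝ E)) : Prop :=
  ∀ p ∈ graph S, ∀ q ∈ graph S, 0 ≤ (p.2 - q.2) (p.1 - q.1)

/-- `S` is maximally monotone: it is maximal among the monotone multifunctions, ordered by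
inclusion of graphs (the pointwise order on `E → Set E*`). -/
def IsMaximallyMonotone (S : E → Set (StrongDual ℝ E)) : Prop :=
  Maximal (fun T : E → Set (StrongDual ℝ E) => IsMonotone T) S

/-- `S` is quasidense: for all `(x, x*)`, the infimum over `(s, s*) ∈ G(S)` of
`½‖s - x‖² + ½‖s* - x*‖² + ⟨s - x, s* - x*⟩` is at most `0`.
The infimum is taken in the extended reals. -/
def IsQuasidense (S : E → Set (StrongDual ℝ E)) : Prop :=
  ∀ (x : E) (x' : StrongDual ℝ E),
    (⨅ p ∈ graph S,
      (((1 / 2 : ℝ) * ‖p.1 - x‖ ^ 2 + (1 / 2 : ℝ) * ‖p.2 - x'‖ ^ 2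
        + (p.2 - x') (p.1 - x) : ℝ) : EReal)) ≤ 0

/-- `S` is of type (FP), or locally maximally monotone. Openness is with respect to the
norm topology of `E*`. -/
def IsTypeFP (S : E → Set (StrongDual ℝ E)) : Prop :=
  IsMonotone S ∧
    ∀ U : Set (StrongDual ℝ E), Convex ℝ U → IsOpen U → (U ∩ range S).Nonempty →
      ∀ (w : E) (w' : StrongDual ℝ E), w' ∈ U →
        (∀ p ∈ graph S, p.2 ∈ U → 0 ≤ (p.2 - w') (p.1 - w)) →
        (w, w') ∈ graph S

/-- `S` is of type (NI): for all `(w*, w**) ∈ E* × E**`, the infimum over `(s, s*) ∈ G(S)` of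
`⟨s* - w*, ŝ - w**⟩` is at most `0`, where `ŝ` is the canonical image of `s` in the bidual.
The infimum is taken in the extended reals. -/
def IsTypeNI (S : E → Set (StrongDual ℝ E)) : Prop :=
  ∀ (w' : StrongDual ℝ E) (w'' : StrongDual ℝ (StrongDual ℝ E)),
    (⨅ p ∈ graph S,
      (((NormedSpace.inclusionInDoubleDual ℝ E p.1 - w'') (p.2 - w') : ℝ) : EReal)) ≤ 0

end Multifunction

/-! Let `h` be `½‖·‖²` on a convex, weak*-closed set `V ⊆ E*` and `∞` elsewhere, and let `w` be a
point such that `V` is a neighbourhood of `y* - w*` for some `(y, y*) ∈ G(S)`. Condition (NI) is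
exactly what is needed for Fenchel duality to show that the Fitzpatrick function of `G(S) - w` plus
`h(x*) + h*(-x)` has infimum at most `0`. Hence there are points `b` monotonically related to
`G(S)` up to an arbitrarily small error such that `b* - w*` almost minimizes
`⟨b - w, ·⟩ + ½‖·‖²` over `V`. Iterating this with `V = E*`, as in the Brøndsted–Rockafellar
theorem, moves `b` into `G(S)` by a small displacement. The choice `V = E*` then gives
quasidensity, and letting `V` be a tube around the segment from `0` to `y* - w*`, inside `U - w*`,
gives (FP).

Conversely, quasidensity implies (NI) by the Fenchel–Young inequality, and (FP) implies (NI) by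
testing it on an open half-space. -/

open Set Metric Filter Topology Pointwise

namespace Multifunction

theorem biInf_coe_le_zero_iff {α : Type*} {G : Set α} {f : α → ℝ} :
    (⨅ p ∈ G, (f p : EReal)) ≤ 0 ↔ ∀ ε > 0, ∃ p ∈ G, f p < ε := by
  constructor
  · intro h ε hε
    have h' : (⨅ p ∈ G, (f p : EReal)) < (ε : EReal) := h.trans_lt (by exact_mod_cast hε)
    simp only [iInf_lt_iff] at h'
    obtain ⟨p, hp, hlt⟩ := h'
    exact ⟨p, hp, by exact_mod_cast hlt⟩
  · intro h
    refine le_of_forall_gt fun c hc => ?_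
    obtain ⟨ε, hε, hεc⟩ := EReal.lt_iff_exists_real_btwn.1 hc
    obtain ⟨p, hp, hlt⟩ := h ε (by exact_mod_cast hε)
    exact (iInf₂_le p hp).trans_lt (lt_trans (by exact_mod_cast hlt) hεc)

theorem sq_norm_sub_sq_norm_le {F : Type*} [SeminormedAddCommGroup F] (x y : F) :
    ‖x‖ ^ 2 - ‖y‖ ^ 2 ≤ ‖x - y‖ * (‖x‖ + ‖y‖) :=
  calc ‖x‖ ^ 2 - ‖y‖ ^ 2 = (‖x‖ - ‖y‖) * (‖x‖ + ‖y‖) := by ring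
    _ ≤ ‖x - y‖ * (‖x‖ + ‖y‖) := by gcongr; exact norm_sub_norm_le x y

section Seminormed

variable {F : Type*} [SeminormedAddCommGroup F] [NormedSpace ℝ F]

theorem neg_half_sq_norm_add_le_apply (f : StrongDual ℝ F) (x : F) :
    -(1 / 2 * ‖f‖ ^ 2 + 1 / 2 * ‖x‖ ^ 2) ≤ f x := by
  have h : -(‖f‖ * ‖x‖) ≤ f x := (abs_le.1 (f.le_opNorm x)).1
  linarith [two_mul_le_add_sq ‖f‖ ‖x‖]

theorem exists_apply_add_half_sq_norm_lt (f : StrongDual ℝ F) {ε : ℝ} (hε : 0 < ε) :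
    ∃ z : F, f z + 1 / 2 * ‖z‖ ^ 2 < -(1 / 2 * ‖f‖ ^ 2) + ε := by
  by_contra! h
  set c := ‖f‖ ^ 2 - 2 * ε
  have hc0 : 0 ≤ c := by
    have := h 0
    simp only [map_zero, norm_zero] at this
    linarith
  have hbound : ∀ x, ‖f x‖ ≤ √c * ‖x‖ := by
    intro x
    -- `t ↦ f (t • x) + ½‖t • x‖² + c / 2` is a nonnegative quadratic polynomial
    have hdiscrim := discrim_le_zero (a := 1 / 2 * ‖x‖ ^ 2) (b := f x) (c := 1 / 2 * c) fun t => by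
      have := h (t • x)
      rw [map_smul, smul_eq_mul, norm_smul, mul_pow, Real.norm_eq_abs, sq_abs] at this
      linarith
    refine abs_le_of_sq_le_sq ?_ (by positivity)
    rw [mul_pow, Real.sq_sqrt hc0]
    linarith [hdiscrim, discrim.eq_1 (1 / 2 * ‖x‖ ^ 2) (f x) (1 / 2 * c)]
  have hle : ‖f‖ ^ 2 ≤ c := by
    rw [← Real.sq_sqrt hc0]
    gcongr
    exact f.opNorm_le_bound (Real.sqrt_nonneg c) hbound
  linarith

theorem abs_apply_sub_apply_le (a b : F × StrongDual ℝ F) :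
    |a.2 a.1 - b.2 b.1| ≤ ‖a - b‖ * (‖a‖ + ‖b‖) :=
  calc |a.2 a.1 - b.2 b.1| = |(a - b).2 a.1 + b.2 (a - b).1| := by simp
    _ ≤ ‖(a - b).2‖ * ‖a.1‖ + ‖b.2‖ * ‖(a - b).1‖ :=
      (abs_add_le _ _).trans (add_le_add ((a - b).2.le_opNorm _) (b.2.le_opNorm _))
    _ ≤ ‖a - b‖ * ‖a‖ + ‖b‖ * ‖a - b‖ := by
      gcongr <;> first | exact norm_fst_le _ | exact norm_snd_le _
    _ = ‖a - b‖ * (‖a‖ + ‖b‖) := by ring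

theorem exists_apply_eq_bidual_apply (f : StrongDual ℝ F)
    (φ : StrongDual ℝ (StrongDual ℝ F)) : ∃ x, f x = φ f := by
  rcases eq_or_ne f 0 with rfl | hf
  · exact ⟨0, by simp⟩
  · exact LinearMap.surjective (f := f.toLinearMap)
      (fun h => hf (ContinuousLinearMap.coe_injective h)) (φ f)

end Seminormed

theorem exists_nonvertical_separation {F : Type*} [AddCommGroup F] [Module ℝ F]
    [TopologicalSpace F] [IsTopologicalAddGroup F] [ContinuousSMul ℝ F] {A D : Set (F × ℝ)}
    (hAD : Disjoint A D) (hA : Convex ℝ A) (hD : Convex ℝ D) {x : F} {s t : ℝ}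
    (hs : (x, s) ∈ interior D) (ht : (x, t) ∈ A) (hst : s < t) :
    ∃ (φ : StrongDual ℝ F) (c : ℝ),
      (∀ b ∈ A, c ≤ φ b.1 + b.2) ∧ ∀ b ∈ D, φ b.1 + b.2 ≤ c := by
  obtain ⟨f, u, hfD, hfA⟩ := geometric_hahn_banach_open hD.interior isOpen_interior hA
    (hAD.symm.mono_left interior_subset)
  have hfD' : ∀ b ∈ D, f b ≤ u := by
    have hsub : closure (interior D) ⊆ f ⁻¹' Iic u :=
      closure_minimal (fun b hb => (hfD b hb).le) (isClosed_Iic.preimage f.continuous)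
    rw [hD.closure_interior_eq_closure_of_nonempty_interior ⟨_, hs⟩] at hsub
    exact fun b hb => hsub (subset_closure hb)
  set α := f (0, 1) with hα
  have hf : ∀ b, f b = f (b.1, 0) + b.2 * α := fun b => by
    rw [hα, ← smul_eq_mul, ← map_smul, ← map_add]
    simp
  have hαpos : 0 < α := by
    have hlt := (hfD _ hs).trans_le (hfA _ ht)
    rw [hf, hf (x, t)] at hlt
    dsimp only at hlt
    have : 0 < (t - s) * α := by linarith
    exact pos_of_mul_pos_right this (sub_pos.2 hst).le
  have hscale : ∀ b, (α⁻¹ • f.comp (ContinuousLinearMap.inl ℝ F ℝ)) b.1 + b.2 = f b / α := by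
    intro b
    rw [hf b, add_div, mul_div_cancel_right₀ _ hαpos.ne', div_eq_inv_mul]
    rfl
  refine ⟨α⁻¹ • f.comp (ContinuousLinearMap.inl ℝ F ℝ), u / α, fun b hb => ?_, fun b hb => ?_⟩
  · rw [hscale]
    exact div_le_div_of_nonneg_right (hfA b hb) hαpos.le
  · rw [hscale]
    exact div_le_div_of_nonneg_right (hfD' b hb) hαpos.le

variable {E : Type*} [NormedAddCommGroup E] [NormedSpace ℝ E]

section WeakStar

variable {V : Set (StrongDual ℝ E)}

theorem exists_forall_apply_le_of_notMem (hV : Convex ℝ V)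
    (hVclosed : IsClosed (WeakDual.toStrongDual ⁻¹' V)) {a : StrongDual ℝ E} (ha : a ∉ V) :
    ∃ (x : E) (c : ℝ), (∀ z ∈ V, z x ≤ c) ∧ c < a x := by
  have : LocallyConvexSpace ℝ (WeakDual ℝ E) :=
    inferInstanceAs (LocallyConvexSpace ℝ (WeakBilin (topDualPairing ℝ E)))
  have hVconv : Convex ℝ (WeakDual.toStrongDual ⁻¹' V) :=
    hV.linear_preimage WeakDual.toStrongDual.toLinearMap
  obtain ⟨f, u, hf, hfa⟩ := geometric_hahn_banach_closed_point hVconv hVclosed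
    (x := StrongDual.toWeakDual a) ha
  obtain ⟨x, rfl⟩ := LinearMap.dualEmbedding_surjective (topDualPairing ℝ E) f
  exact ⟨x, u, fun z hz => (hf (StrongDual.toWeakDual z) hz).le, hfa⟩

theorem isClosed_toStrongDual_preimage_cthickening {K : Set (StrongDual ℝ E)}
    (hK : IsCompact K) {δ : ℝ} (hδ : 0 ≤ δ) :
    IsClosed (WeakDual.toStrongDual ⁻¹' cthickening δ K) := by
  have hsum : WeakDual.toStrongDual ⁻¹' cthickening δ K =
      StrongDual.toWeakDual '' K + WeakDual.toStrongDual ⁻¹' closedBall (0 : StrongDual ℝ E) δ := by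
    rw [← hK.add_closedBall_zero hδ, ← StrongDual.symm_toWeakDual,
      ← LinearEquiv.image_eq_preimage_symm, ← LinearEquiv.image_eq_preimage_symm, image_add]
  rw [hsum]
  exact ((hK.image NormedSpace.Dual.toWeakDual_continuous).add
    (WeakDual.isCompact_closedBall (𝕜 := ℝ) (0 : StrongDual ℝ E) δ)).isClosed

end WeakStar

section ApproxMinimizers

/-- The pairs `(x, x')` such that `x'` minimizes `z ↦ ⟨x, z⟩ + ½‖z‖²` over `V` up to an error `ε`;
equivalently, `-x` is an `ε`-subgradient at `x'` of `½‖·‖²` restricted to `V`. -/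
def approxMinimizers (V : Set (StrongDual ℝ E)) (ε : ℝ) : Set (E × StrongDual ℝ E) :=
  {b | b.2 ∈ V ∧ ∀ z ∈ V, b.2 b.1 + 1 / 2 * ‖b.2‖ ^ 2 ≤ z b.1 + 1 / 2 * ‖z‖ ^ 2 + ε}

variable {V : Set (StrongDual ℝ E)} {ε : ℝ} {b : E × StrongDual ℝ E}

theorem approxMinimizers_mono {ε' : ℝ} (h : ε ≤ ε') :
    approxMinimizers V ε ⊆ approxMinimizers V ε' :=
  fun _ hb => ⟨hb.1, fun z hz => (hb.2 z hz).trans (by gcongr)⟩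

theorem apply_add_le_of_mem_approxMinimizers (hb : b ∈ approxMinimizers V ε)
    {c : StrongDual ℝ E} {r : ℝ} (hr : 0 ≤ r) (hV : closedBall c r ⊆ V) :
    b.2 b.1 + 1 / 2 * ‖b.2‖ ^ 2 + r * ‖b.1‖ ≤ c b.1 + 1 / 2 * (‖c‖ + r) ^ 2 + ε := by
  obtain ⟨g, hg, hgb⟩ := exists_dual_vector'' ℝ b.1
  replace hgb : g b.1 = ‖b.1‖ := hgb
  have hrg : ‖r • g‖ ≤ r := by
    rw [norm_smul, Real.norm_of_nonneg hr]
    exact mul_le_of_le_one_right hr hg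
  have hmin := hb.2 (c - r • g) (hV (by simpa [dist_eq_norm] using hrg))
  have hnorm : ‖c - r • g‖ ^ 2 ≤ (‖c‖ + r) ^ 2 := by
    gcongr
    exact (norm_sub_le _ _).trans (by gcongr)
  rw [sub_apply, smul_apply, smul_eq_mul, hgb] at hmin
  linarith

theorem apply_add_half_sq_norm_le_of_mem_approxMinimizers_univ
    (hb : b ∈ approxMinimizers univ ε) :
    b.2 b.1 + 1 / 2 * ‖b.1‖ ^ 2 + 1 / 2 * ‖b.2‖ ^ 2 ≤ ε := by
  have h := apply_add_le_of_mem_approxMinimizers hb (c := 0) (norm_nonneg b.1) (subset_univ _)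
  rw [zero_apply, norm_zero] at h
  linarith

theorem norm_le_of_mem_approxMinimizers (hb : b ∈ approxMinimizers V ε) (hpos : -ε ≤ b.2 b.1)
    {ρ : ℝ} (hρ : 0 < ρ) (hV : closedBall 0 ρ ⊆ V) (hε : ε ≤ 1 / 4 * ρ ^ 2) : ‖b‖ ≤ ρ := by
  have hfst := apply_add_le_of_mem_approxMinimizers hb hρ.le hV
  have hsnd := hb.2 0 (hV (mem_closedBall_self hρ.le))
  simp only [zero_apply, norm_zero] at hfst hsnd
  refine (Prod.norm_def _).trans_le (max_le ?_ ?_)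
  · refine le_of_mul_le_mul_left (a := ρ) ?_ hρ
    linarith [sq_nonneg ‖b.2‖]
  · exact le_of_sq_le_sq (by linarith) hρ.le

end ApproxMinimizers

/-- The `e`-enlargement of the graph of `S`: the pairs that are monotonically related to all of
`G(S)` up to an error `e`. For maximally monotone `S` these are approximate elements of `G(S)`, and
exactly the elements of `G(S)` if `e = 0`. -/
def enlargement (S : E → Set (StrongDual ℝ E)) (e : ℝ) : Set (E × StrongDual ℝ E) :=
  {b | ∀ p ∈ graph S, -e ≤ (p.2 - b.2) (p.1 - b.1)}

section Enlargement

variable {S : E → Set (StrongDual ℝ E)} {e : ℝ} {b : E × StrongDual ℝ E}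

theorem enlargement_mono {e' : ℝ} (h : e ≤ e') : enlargement S e ⊆ enlargement S e' :=
  fun _ hb p hp => (neg_le_neg h).trans (hb p hp)

theorem isClosed_enlargement : IsClosed (enlargement S e) := by
  simp only [enlargement, ofPred_forall]
  exact isClosed_biInter fun p _ => isClosed_le continuous_const
    ((continuous_const.sub continuous_snd).clm_apply (continuous_const.sub continuous_fst))

theorem IsMaximallyMonotone.enlargement_zero (hS : IsMaximallyMonotone S) :
    enlargement S 0 = graph S := by
  refine Subset.antisymm (fun b hb => ?_) fun b hb p hp => by simpa using hS.prop p hp b hb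
  simp only [enlargement, neg_zero] at hb
  have hT : IsMonotone (fun x => {x' | x' ∈ S x ∨ (x, x') = b}) := by
    rintro p (hp | rfl) q (hq | hq)
    · exact hS.prop p hp q hq
    · obtain rfl : q = b := hq
      exact hb p hp
    · have := hb q hq
      rwa [← neg_sub q.2, ← neg_sub q.1, neg_apply, map_neg, neg_neg]
    · obtain rfl : q = p := hq
      simp
  exact hS.le_of_ge hT (fun x x' hx' => Or.inl hx') b.1 (Or.inr rfl)

theorem IsMaximallyMonotone.isClosed_graph (hS : IsMaximallyMonotone S) : IsClosed (graph S) :=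
  hS.enlargement_zero ▸ isClosed_enlargement

theorem IsMaximallyMonotone.graph_nonempty (hS : IsMaximallyMonotone S) :
    (graph S).Nonempty := by
  by_contra! h
  have hmem : ((0, 0) : E × StrongDual ℝ E) ∈ enlargement S 0 := by simp [enlargement, h]
  rw [hS.enlargement_zero, h] at hmem
  exact hmem

theorem IsMaximallyMonotone.nonneg_of_mem_enlargement (hS : IsMaximallyMonotone S)
    (hb : b ∈ enlargement S e) : 0 ≤ e := by
  by_contra! he
  have hmem : b ∈ graph S := hS.enlargement_zero ▸ enlargement_mono he.le hb
  have := hb b hmem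
  simp only [sub_self, map_zero] at this
  linarith

theorem IsMaximallyMonotone.neg_two_mul_add_le {e' : ℝ} {c : E × StrongDual ℝ E}
    (hS : IsMaximallyMonotone S) (hb : b ∈ enlargement S e) (hc : c ∈ enlargement S e') :
    -(2 * (e + e')) ≤ (c.2 - b.2) (c.1 - b.1) := by
  have hmid : (1 / 2 : ℝ) • (b + c) ∈
      enlargement S (1 / 2 * (e + e') + 1 / 4 * (c.2 - b.2) (c.1 - b.1)) := by
    intro p hp
    have h1 := hb p hp
    have h2 := hc p hp
    simp only [Prod.smul_fst, Prod.smul_snd, Prod.fst_add, Prod.snd_add, map_sub, map_add,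
      sub_apply, add_apply, smul_apply, map_smul, smul_eq_mul] at h1 h2 ⊢
    linarith
  linarith [hS.nonneg_of_mem_enlargement hmid]

theorem isBounded_setOf_mem_enlargement_sub_mem_approxMinimizers {w y : E × StrongDual ℝ E}
    (hy : y ∈ graph S) {V : Set (StrongDual ℝ E)} (hyV : y.2 - w.2 ∈ interior V) :
    Bornology.IsBounded {b ∈ enlargement S e | b - w ∈ approxMinimizers V e} := by
  obtain ⟨δ, hδ, hball⟩ := nhds_basis_closedBall.mem_iff.1 (mem_interior_iff_mem_nhds.1 hyV)
  set v := y - w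
  set C := 2 * e + v.2 v.1 + 1 / 2 * (‖v.2‖ + δ) ^ 2 + 1 / 2 * ‖v.1‖ ^ 2 with hC
  refine (isBounded_iff_subset_closedBall w).2
    ⟨max (C / δ) (‖v.1‖ + 1 / 2 + C), fun b ⟨hb, hbV⟩ => mem_closedBall_iff_norm.2 ?_⟩
  set d := b - w
  have hmin : d.2 d.1 + 1 / 2 * ‖d.2‖ ^ 2 + δ * ‖d.1‖ ≤ v.2 d.1 + 1 / 2 * (‖v.2‖ + δ) ^ 2 + e :=
    apply_add_le_of_mem_approxMinimizers hbV hδ.le hball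
  have henl : -e ≤ (v.2 - d.2) (v.1 - d.1) := by
    have := hb y hy
    rwa [← sub_sub_sub_cancel_right y.2 b.2 w.2, ← sub_sub_sub_cancel_right y.1 b.1 w.1] at this
  simp only [map_sub, sub_apply] at henl
  have hpair : -(‖d.2‖ * ‖v.1‖) ≤ d.2 v.1 := (abs_le.1 (d.2.le_opNorm v.1)).1
  have hdist : 1 / 2 * (‖d.2‖ - ‖v.1‖) ^ 2 + δ * ‖d.1‖ ≤ C := by
    rw [hC]
    linarith
  refine (Prod.norm_def _).trans_le (max_le_max ?_ ?_)
  · rw [le_div_iff₀ hδ]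
    linarith [hdist, sq_nonneg (‖d.2‖ - ‖v.1‖)]
  · have : 0 ≤ δ * ‖d.1‖ := by positivity
    linarith [hdist, sq_nonneg (‖d.2‖ - ‖v.1‖ - 1)]

end Enlargement

section Duality

/-- The epigraph of the Fitzpatrick function
`(x, x') ↦ sup {⟨x, p'⟩ + ⟨p, x'⟩ - ⟨p, p'⟩ | (p, p') ∈ G(S) - w}` of the translate of `S` that
moves `w` to the origin. An epigraph avoids extended real values. -/
def fitzpatrickEpigraph (S : E → Set (StrongDual ℝ E)) (w : E × StrongDual ℝ E) :
    Set ((E × StrongDual ℝ E) × ℝ) :=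
  {b | ∀ p ∈ graph S,
    (p.2 - w.2) b.1.1 + b.1.2 (p.1 - w.1) - (p.2 - w.2) (p.1 - w.1) ≤ b.2}

/-- The hypograph of the concave function `(x, x') ↦ ε - h x' - h* (-x)`, where `h` is `½‖·‖²` on
`V` and `∞` elsewhere, and `h*` is its conjugate. -/
def dualityHypograph (V : Set (StrongDual ℝ E)) (ε : ℝ) : Set ((E × StrongDual ℝ E) × ℝ) :=
  {b | b.1.2 ∈ V ∧ ∀ z ∈ V, b.2 + 1 / 2 * ‖b.1.2‖ ^ 2 ≤ z b.1.1 + 1 / 2 * ‖z‖ ^ 2 + ε}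

variable {S : E → Set (StrongDual ℝ E)} {w : E × StrongDual ℝ E} {V : Set (StrongDual ℝ E)}
  {ε c : ℝ} {a' : StrongDual ℝ E} {a'' : StrongDual ℝ (StrongDual ℝ E)}

theorem convex_fitzpatrickEpigraph : Convex ℝ (fitzpatrickEpigraph S w) := by
  rintro ⟨⟨x, x'⟩, s⟩ hx ⟨⟨y, y'⟩, t⟩ hy a b ha hb hab p hp
  have h1 := mul_le_mul_of_nonneg_left (hx p hp) ha
  have h2 := mul_le_mul_of_nonneg_left (hy p hp) hb
  obtain rfl : b = 1 - a := by linarith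
  simp only [Prod.smul_mk, Prod.mk_add_mk, map_add, map_smul, add_apply, smul_apply,
    smul_eq_mul] at h1 h2 ⊢
  linarith

theorem IsMonotone.mem_fitzpatrickEpigraph (hS : IsMonotone S) {y : E × StrongDual ℝ E}
    (hy : y ∈ graph S) : (y - w, (y.2 - w.2) (y.1 - w.1)) ∈ fitzpatrickEpigraph S w := by
  intro p hp
  have := hS p hp y hy
  simp only [Prod.fst_sub, Prod.snd_sub, sub_apply, map_sub] at this ⊢
  linarith

theorem add_mem_enlargement_of_mem_fitzpatrickEpigraph {b : (E × StrongDual ℝ E) × ℝ}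
    (hb : b ∈ fitzpatrickEpigraph S w) : b.1 + w ∈ enlargement S (b.2 - b.1.2 b.1.1) := by
  intro p hp
  have := hb p hp
  rw [Prod.fst_add, Prod.snd_add, add_comm b.1.1, add_comm b.1.2, ← sub_sub, ← sub_sub]
  simp only [map_sub, sub_apply] at this ⊢
  linarith

theorem convex_dualityHypograph (hV : Convex ℝ V) : Convex ℝ (dualityHypograph V ε) := by
  rintro ⟨⟨x, x'⟩, s⟩ ⟨hx', hx⟩ ⟨⟨y, y'⟩, t⟩ ⟨hy', hy⟩ a b ha hb hab
  refine ⟨hV hx' hy' ha hb hab, fun z hz => ?_⟩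
  have h1 := mul_le_mul_of_nonneg_left (hx z hz) ha
  have h2 := mul_le_mul_of_nonneg_left (hy z hz) hb
  have hnorm := ((convexOn_norm convex_univ).pow (fun x _ => norm_nonneg x) 2).2
    (mem_univ x') (mem_univ y') ha hb hab
  obtain rfl : b = 1 - a := by linarith
  simp only [Prod.smul_mk, Prod.mk_add_mk, map_add, map_smul, smul_eq_mul, Pi.pow_apply]
    at h1 h2 hnorm ⊢
  linarith

theorem mem_interior_dualityHypograph {b : (E × StrongDual ℝ E) × ℝ}
    (hbV : b.1.2 ∈ interior V) (hb : b.2 + 1 / 2 * ‖b.1.2‖ ^ 2 + 1 / 2 * ‖b.1.1‖ ^ 2 < ε) :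
    b ∈ interior (dualityHypograph V ε) := by
  have hopen : IsOpen ({b : (E × StrongDual ℝ E) × ℝ | b.1.2 ∈ interior V} ∩
      {b | b.2 + 1 / 2 * ‖b.1.2‖ ^ 2 + 1 / 2 * ‖b.1.1‖ ^ 2 < ε}) :=
    (isOpen_interior.preimage (by fun_prop)).inter (isOpen_lt (by fun_prop) continuous_const)
  refine interior_maximal ?_ hopen ⟨hbV, hb⟩
  rintro c ⟨hcV, hc⟩
  refine ⟨interior_subset hcV, fun z _ => ?_⟩
  rw [mem_ofPred_eq] at hc
  linarith [neg_half_sq_norm_add_le_apply z c.1.1]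

theorem neg_mem_of_forall_dualityHypograph_le (hV : Convex ℝ V)
    (hVclosed : IsClosed (WeakDual.toStrongDual ⁻¹' V)) (hVne : V.Nonempty)
    (h : ∀ b ∈ dualityHypograph V ε, a' b.1.1 + a'' b.1.2 + b.2 ≤ c) : -a' ∈ V := by
  by_contra hnot
  obtain ⟨x, d, hd, hda⟩ := exists_forall_apply_le_of_notMem hV hVclosed hnot
  obtain ⟨v, hv⟩ := hVne
  rw [neg_apply] at hda
  have hgap : 0 < -(a' x) - d := by linarith
  -- the functional is unbounded above along the ray through `-x`
  obtain ⟨n, hn⟩ := exists_nat_gt ((c - (a'' v + (ε - 1 / 2 * ‖v‖ ^ 2))) / (-(a' x) - d))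
  rw [div_lt_iff₀ hgap] at hn
  have hmem : ((-((n : ℝ) • x), v), ε - 1 / 2 * ‖v‖ ^ 2 - n * d) ∈ dualityHypograph V ε := by
    refine ⟨hv, fun z hz => ?_⟩
    have := mul_le_mul_of_nonneg_left (hd z hz) (Nat.cast_nonneg (α := ℝ) n)
    simp only [map_neg, map_smul, smul_eq_mul]
    linarith [sq_nonneg ‖z‖]
  have := h _ hmem
  simp only [map_neg, map_smul, smul_eq_mul] at this
  linarith

theorem sub_apply_le_of_forall_dualityHypograph_le (ha' : -a' ∈ V)
    (h : ∀ b ∈ dualityHypograph V ε, a' b.1.1 + a'' b.1.2 + b.2 ≤ c) : ε - a'' a' ≤ c := by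
  refine le_of_forall_pos_le_add fun η hη => ?_
  obtain ⟨x, hx⟩ := exists_apply_add_half_sq_norm_lt a' hη
  have hmem : ((-x, -a'), ε - 1 / 2 * ‖a'‖ ^ 2 - 1 / 2 * ‖x‖ ^ 2) ∈ dualityHypograph V ε := by
    refine ⟨ha', fun z _ => ?_⟩
    have := neg_half_sq_norm_add_le_apply z (-x)
    rw [norm_neg] at this ⊢
    linarith
  have := h _ hmem
  simp only [map_neg] at this
  linarith

theorem IsTypeNI.le_neg_apply (hNI : IsTypeNI S)
    (h : ∀ b ∈ graph S, c ≤ a' (b.1 - w.1) + a'' (b.2 - w.2) + (b.2 - w.2) (b.1 - w.1)) :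
    c ≤ -(a'' a') := by
  refine le_of_forall_pos_le_add fun η hη => ?_
  obtain ⟨p, hp, hlt⟩ := biInf_coe_le_zero_iff.1
    (hNI (w.2 - a') (NormedSpace.inclusionInDoubleDual ℝ E w.1 - a'')) η hη
  have := h p hp
  simp only [sub_apply, map_sub, NormedSpace.dual_def] at this hlt
  linarith

theorem IsTypeNI.not_disjoint (hNI : IsTypeNI S) (hS : IsMonotone S) (hV : Convex ℝ V)
    (hVclosed : IsClosed (WeakDual.toStrongDual ⁻¹' V)) {y : E × StrongDual ℝ E}
    (hy : y ∈ graph S) (hyV : y.2 - w.2 ∈ interior V) (hε : 0 < ε) :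
    ¬Disjoint (fitzpatrickEpigraph S w) (dualityHypograph V ε) := by
  -- a separating functional `(a', a'')` would satisfy `ε - a'' a' ≤ c ≤ -a'' a'`
  intro hdisj
  set v := y - w
  set s := -(1 / 2 * ‖v.2‖ ^ 2 + 1 / 2 * ‖v.1‖ ^ 2) - 1 with hs
  have hinterior : (v, s) ∈ interior (dualityHypograph V ε) :=
    mem_interior_dualityHypograph hyV (by rw [hs]; linarith)
  have hlt : s < v.2 v.1 := by linarith [neg_half_sq_norm_add_le_apply v.2 v.1]
  obtain ⟨φ, c, hA, hD⟩ := exists_nonvertical_separation hdisj convex_fitzpatrickEpigraph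
    (convex_dualityHypograph hV) hinterior (hS.mem_fitzpatrickEpigraph hy) hlt
  obtain ⟨a', a'', hφ⟩ : ∃ (a' : StrongDual ℝ E) (a'' : StrongDual ℝ (StrongDual ℝ E)),
      ∀ b, φ b = a' b.1 + a'' b.2 :=
    ⟨φ.comp (.inl ℝ E _), φ.comp (.inr ℝ E _), fun b => (φ.comp_inl_add_comp_inr b).symm⟩
  simp only [hφ] at hA hD
  have hle : c ≤ -(a'' a') := hNI.le_neg_apply fun p hp => hA _ (hS.mem_fitzpatrickEpigraph hp)
  have ha' : -a' ∈ V :=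
    neg_mem_of_forall_dualityHypograph_le hV hVclosed ⟨_, interior_subset hyV⟩ hD
  linarith [sub_apply_le_of_forall_dualityHypograph_le ha' hD]

theorem IsTypeNI.exists_mem_enlargement (hNI : IsTypeNI S) (hS : IsMaximallyMonotone S)
    (hV : Convex ℝ V) (hVclosed : IsClosed (WeakDual.toStrongDual ⁻¹' V))
    {y : E × StrongDual ℝ E} (hy : y ∈ graph S) (hyV : y.2 - w.2 ∈ interior V) (hε : 0 < ε) :
    ∃ b ∈ enlargement S ε, b - w ∈ approxMinimizers V ε := by
  obtain ⟨b, hbA, hbV, hbD⟩ := not_disjoint_iff.1 (hNI.not_disjoint hS.prop hV hVclosed hy hyV hε)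
  have hb := add_mem_enlargement_of_mem_fitzpatrickEpigraph hbA
  refine ⟨b.1 + w, enlargement_mono ?_ hb, ?_⟩
  · linarith [hbD _ hbV]
  · rw [add_sub_cancel_right]
    exact ⟨hbV, fun z hz => by linarith [hbD z hz, hS.nonneg_of_mem_enlargement hb]⟩

end Duality

section BronstedRockafellar

variable {S : E → Set (StrongDual ℝ E)} {ε : ℝ}

theorem IsTypeNI.exists_mem_enlargement_dist_le (hNI : IsTypeNI S) (hS : IsMaximallyMonotone S)
    (hε : 0 < ε) {b : E × StrongDual ℝ E} (hb : b ∈ enlargement S (ε ^ 2)) :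
    ∃ c ∈ enlargement S ((ε / 2) ^ 2), dist b c ≤ 3 * ε := by
  obtain ⟨y, hy⟩ := hS.graph_nonempty
  obtain ⟨c, hc, hcb⟩ := hNI.exists_mem_enlargement hS (w := b) (V := univ) (ε := (ε / 2) ^ 2)
    convex_univ isClosed_univ hy (by simp) (by positivity)
  refine ⟨c, hc, ?_⟩
  have hupper := apply_add_half_sq_norm_le_of_mem_approxMinimizers_univ hcb
  have hlower : -(2 * (ε ^ 2 + (ε / 2) ^ 2)) ≤ (c - b).2 (c - b).1 :=
    hS.neg_two_mul_add_le hb hc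
  rw [dist_comm, dist_eq_norm]
  refine (Prod.norm_def _).trans_le (max_le ?_ ?_) <;>
    refine le_of_sq_le_sq ?_ (by positivity)
  · linarith [sq_nonneg ‖(c - b).2‖, sq_nonneg ε]
  · linarith [sq_nonneg ‖(c - b).1‖, sq_nonneg ε]

theorem IsTypeNI.exists_mem_graph_dist_le [CompleteSpace E] (hNI : IsTypeNI S)
    (hS : IsMaximallyMonotone S) (hε : 0 < ε) {b : E × StrongDual ℝ E}
    (hb : b ∈ enlargement S (ε ^ 2)) : ∃ s ∈ graph S, dist b s ≤ 6 * ε := by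
  have hstep : ∀ (n : ℕ) (c : enlargement S ((ε / 2 ^ n) ^ 2)),
      ∃ d : enlargement S ((ε / 2 ^ (n + 1)) ^ 2), dist c.1 d.1 ≤ 6 * ε / 2 / 2 ^ n := by
    intro n c
    obtain ⟨d, hd, hcd⟩ := hNI.exists_mem_enlargement_dist_le hS (by positivity) c.2
    rw [div_div, ← pow_succ] at hd
    exact ⟨⟨d, hd⟩, hcd.trans_eq (by ring)⟩
  choose next hnext using hstep
  let f : ∀ n : ℕ, enlargement S ((ε / 2 ^ n) ^ 2) := Nat.rec ⟨b, by simpa using hb⟩ next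
  have hf : ∀ n, dist (f n).1 (f (n + 1)).1 ≤ 6 * ε / 2 / 2 ^ n := fun n => hnext n (f n)
  obtain ⟨s, hs⟩ := cauchySeq_tendsto_of_complete (cauchySeq_of_le_geometric_two hf)
  refine ⟨s, ?_, dist_le_of_le_geometric_two_of_tendsto₀ hf hs⟩
  have hcont : ∀ p : E × StrongDual ℝ E,
      Continuous fun c : E × StrongDual ℝ E => (p.2 - c.2) (p.1 - c.1) := fun p =>
    (continuous_const.sub continuous_snd).clm_apply (continuous_const.sub continuous_fst)
  have hzero : Tendsto (fun n : ℕ => -(ε / 2 ^ n) ^ 2) atTop (𝓝 (-0)) := by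
    have : Tendsto (fun n : ℕ => ε / 2 ^ n) atTop (𝓝 0) :=
      tendsto_const_nhds.div_atTop (tendsto_pow_atTop_atTop_of_one_lt one_lt_two)
    simpa using (this.pow 2).neg
  rw [← hS.enlargement_zero]
  exact fun p hp =>
    le_of_tendsto_of_tendsto' hzero (((hcont p).tendsto s).comp hs) fun n => (f n).2 p hp

theorem IsTypeNI.exists_mem_graph_near_approxMinimizers [CompleteSpace E] (hNI : IsTypeNI S)
    (hS : IsMaximallyMonotone S) {V : Set (StrongDual ℝ E)} (hV : Convex ℝ V)
    (hVclosed : IsClosed (WeakDual.toStrongDual ⁻¹' V)) {w y : E × StrongDual ℝ E}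
    (hy : y ∈ graph S) (hyV : y.2 - w.2 ∈ interior V) (hε : 0 < ε) :
    ∃ s ∈ graph S, ∃ b, b - w ∈ approxMinimizers V ε ∧ ‖s - b‖ ≤ ε ∧
      ‖s - b‖ * (‖s - w‖ + ‖b - w‖) ≤ ε := by
  obtain ⟨R, hR, hsub⟩ := (isBounded_setOf_mem_enlargement_sub_mem_approxMinimizers
    (e := 1) hy hyV).subset_closedBall_lt 0 w
  set M := 2 * R + 1
  have hM : 1 ≤ M := le_add_of_nonneg_left (by positivity)
  set η := min 1 ε / M
  have hηpos : 0 < η := by positivity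
  have hηM : η * M = min 1 ε := div_mul_cancel₀ _ (by positivity)
  have hηle : η ≤ min 1 ε := div_le_self (by positivity) hM
  have hη1 : η ≤ 1 := hηle.trans (min_le_left _ _)
  have hηε : η ≤ ε := hηle.trans (min_le_right _ _)
  have hsq : (η / 6) ^ 2 ≤ η := by nlinarith
  obtain ⟨b, hb, hbV⟩ := hNI.exists_mem_enlargement hS hV hVclosed hy hyV (ε := (η / 6) ^ 2)
    (by positivity)
  obtain ⟨s, hs, hbs⟩ := hNI.exists_mem_graph_dist_le hS (by positivity) hb
  have hsb : ‖s - b‖ ≤ η := by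
    rw [← dist_eq_norm, dist_comm]
    linarith
  have hbw : ‖b - w‖ ≤ R := mem_closedBall_iff_norm.1 <| hsub
    ⟨enlargement_mono (hsq.trans hη1) hb, approxMinimizers_mono (hsq.trans hη1) hbV⟩
  have hsw : ‖s - w‖ ≤ R + 1 := by linarith [norm_sub_le_norm_sub_add_norm_sub s b w]
  refine ⟨s, hs, b, approxMinimizers_mono (hsq.trans hηε) hbV, hsb.trans hηε, ?_⟩
  calc ‖s - b‖ * (‖s - w‖ + ‖b - w‖) ≤ η * M := by gcongr; linarith
    _ ≤ ε := hηM.trans_le (min_le_right _ _)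

end BronstedRockafellar

variable {S : E → Set (StrongDual ℝ E)}

theorem IsQuasidense.isTypeNI (hS : IsQuasidense S) : IsTypeNI S := by
  intro w' w''
  rw [biInf_coe_le_zero_iff]
  intro ε hε
  obtain ⟨z, hz⟩ := exists_apply_add_half_sq_norm_lt w'' (half_pos hε)
  obtain ⟨p, hp, hlt⟩ := biInf_coe_le_zero_iff.1 (hS 0 (w' - z)) (ε / 2) (half_pos hε)
  refine ⟨p, hp, ?_⟩
  have hz' := neg_half_sq_norm_add_le_apply z p.1
  have hw'' := neg_half_sq_norm_add_le_apply w'' (p.2 - (w' - z))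
  simp only [sub_zero, sub_apply, map_sub, NormedSpace.dual_def] at hlt hw'' ⊢
  linarith

theorem IsTypeFP.isTypeNI (hS : IsTypeFP S) (hne : (graph S).Nonempty) : IsTypeNI S := by
  intro w' w''
  rw [biInf_coe_le_zero_iff]
  intro ε hε
  by_contra! hcon
  obtain ⟨⟨y, y'⟩, hy⟩ := hne
  obtain ⟨w, hw⟩ := exists_apply_eq_bidual_apply (y' - w') w''
  set φ := w'' - NormedSpace.inclusionInDoubleDual ℝ E w with hφ
  have hφy : φ (y' - w') = 0 := by
    rw [hφ, sub_apply, NormedSpace.dual_def, hw, sub_self]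
  have hmem : (w, w') ∈ graph S := by
    refine hS.2 {z | -ε < φ (z - w')} ?_ (isOpen_lt continuous_const (by fun_prop))
      ⟨y', ?_, mem_iUnion.2 ⟨y, hy⟩⟩ w w' ?_ fun p hp hpU => ?_
    · simp only [map_sub, lt_sub_iff_add_lt]
      exact convex_halfSpace_gt φ.isLinear _
    · simpa only [mem_ofPred_eq, hφy, neg_lt_zero] using hε
    · simpa using hε
    · have := hcon p hp
      simp only [mem_ofPred_eq, hφ, sub_apply, map_sub, NormedSpace.dual_def] at this hpU ⊢
      linarith
  have := hcon _ hmem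
  simp only [sub_self, map_zero] at this
  linarith

theorem IsTypeNI.isQuasidense [CompleteSpace E] (hNI : IsTypeNI S)
    (hS : IsMaximallyMonotone S) : IsQuasidense S := by
  intro x x'
  rw [biInf_coe_le_zero_iff]
  intro ε hε
  obtain ⟨y, hy⟩ := hS.graph_nonempty
  set w := (x, x')
  obtain ⟨s, hs, b, hbV, -, hsb⟩ := hNI.exists_mem_graph_near_approxMinimizers hS (w := w)
    convex_univ isClosed_univ hy (by simp) (ε := ε / 4) (by positivity)
  refine ⟨s, hs, ?_⟩
  have hmin := apply_add_half_sq_norm_le_of_mem_approxMinimizers_univ hbV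
  rw [← sub_sub_sub_cancel_right s b w] at hsb
  set d := s - w
  set d₀ := b - w
  have hpair := (le_abs_self _).trans ((abs_apply_sub_apply_le d d₀).trans hsb)
  have hfst : ‖d.1‖ ^ 2 - ‖d₀.1‖ ^ 2 ≤ ε / 4 := by
    refine (sq_norm_sub_sq_norm_le _ _).trans (le_trans ?_ hsb)
    gcongr
    exacts [norm_fst_le (d - d₀), norm_fst_le d, norm_fst_le d₀]
  have hsnd : ‖d.2‖ ^ 2 - ‖d₀.2‖ ^ 2 ≤ ε / 4 := by
    refine (sq_norm_sub_sq_norm_le _ _).trans (le_trans ?_ hsb)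
    gcongr
    exacts [norm_snd_le (d - d₀), norm_snd_le d, norm_snd_le d₀]
  change 1 / 2 * ‖d.1‖ ^ 2 + 1 / 2 * ‖d.2‖ ^ 2 + d.2 d.1 < ε
  linarith

theorem IsTypeNI.exists_mem_graph_norm_sub_le [CompleteSpace E] (hNI : IsTypeNI S)
    (hS : IsMaximallyMonotone S) {V : Set (StrongDual ℝ E)} (hV : Convex ℝ V)
    (hVclosed : IsClosed (WeakDual.toStrongDual ⁻¹' V)) {w y : E × StrongDual ℝ E}
    (hy : y ∈ graph S) (hyV : y.2 - w.2 ∈ interior V) {ρ : ℝ} (hρ : 0 < ρ)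
    (hball : closedBall 0 ρ ⊆ V)
    (hw : ∀ s ∈ graph S, s.2 - w.2 ∈ cthickening ρ V → 0 ≤ (s.2 - w.2) (s.1 - w.1)) :
    ∃ s ∈ graph S, ‖s - w‖ ≤ 2 * ρ := by
  obtain ⟨s, hs, b, hbV, hsb, hsb'⟩ := hNI.exists_mem_graph_near_approxMinimizers hS hV hVclosed
    hy hyV (ε := min ρ (1 / 4 * ρ ^ 2)) (by positivity)
  refine ⟨s, hs, ?_⟩
  have hsρ : ‖s - b‖ ≤ ρ := hsb.trans (min_le_left _ _)
  have hsV : s.2 - w.2 ∈ cthickening ρ V := by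
    refine closedBall_subset_cthickening hbV.1 ρ (mem_closedBall_iff_norm.2 ?_)
    rw [Prod.snd_sub, sub_sub_sub_cancel_right]
    exact (norm_snd_le (s - b)).trans hsρ
  have hpair : -min ρ (1 / 4 * ρ ^ 2) ≤ (b - w).2 (b - w).1 := by
    rw [← sub_sub_sub_cancel_right s b w] at hsb'
    have hdiff := (le_abs_self _).trans ((abs_apply_sub_apply_le _ _).trans hsb')
    have hnonneg : 0 ≤ (s - w).2 (s - w).1 := hw s hs hsV
    linarith
  have hbρ : ‖b - w‖ ≤ ρ :=
    norm_le_of_mem_approxMinimizers hbV hpair hρ hball (min_le_right _ _)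
  linarith [norm_sub_le_norm_sub_add_norm_sub s b w]

theorem IsTypeNI.isTypeFP [CompleteSpace E] (hNI : IsTypeNI S) (hS : IsMaximallyMonotone S) :
    IsTypeFP S := by
  refine ⟨hS.prop, fun U hUconv hUo ⟨y', hy'U, hy'⟩ w w' hw' hrel => ?_⟩
  obtain ⟨y, hy⟩ := mem_iUnion.1 hy'
  set K := segment ℝ 0 (y' - w')
  have hK : IsCompact K := by
    simp only [K, segment_eq_image]
    exact isCompact_Icc.image (by fun_prop)
  have hKU : K ⊆ {z | z + w' ∈ U} :=
    (hUconv.translate_preimage_left w').segment_subset (by simpa using hw') (by simpa using hy'U)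
  obtain ⟨δ, hδ, hδU⟩ := hK.exists_cthickening_subset_open
    (hUo.preimage (continuous_id.add continuous_const)) hKU
  set V := cthickening (δ / 2) K
  have hball : ∀ z ∈ K, closedBall z (δ / 2) ⊆ V := fun z hz => closedBall_subset_cthickening hz _
  have hyV : y' - w' ∈ interior V := mem_interior_iff_mem_nhds.2 <|
    mem_of_superset (closedBall_mem_nhds _ (half_pos hδ)) (hball _ (right_mem_segment _ _ _))
  have hVU : ∀ ρ ≤ δ / 2, cthickening ρ V ⊆ {z | z + w' ∈ U} := fun ρ hρ =>
    ((cthickening_mono hρ V).trans (cthickening_cthickening_subset (half_pos hδ).le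
      (half_pos hδ).le K)).trans ((add_halves δ).symm ▸ hδU)
  rw [← hS.isClosed_graph.closure_eq, Metric.mem_closure_iff]
  intro τ hτ
  set ρ := min (δ / 2) (τ / 3)
  have hρδ : ρ ≤ δ / 2 := min_le_left _ _
  obtain ⟨s, hs, hsw⟩ := hNI.exists_mem_graph_norm_sub_le hS (w := (w, w')) (y := (y, y'))
    ((convex_segment _ _).cthickening _)
    (isClosed_toStrongDual_preimage_cthickening hK (half_pos hδ).le) hy hyV (ρ := ρ)
    (by positivity)
    ((closedBall_subset_closedBall hρδ).trans (hball 0 (left_mem_segment _ _ _)))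
    fun s hs hsV => hrel s hs (by simpa using hVU ρ hρδ hsV)
  refine ⟨s, hs, ?_⟩
  rw [dist_comm, dist_eq_norm]
  linarith [min_le_right (δ / 2) (τ / 3)]

end Multifunction

theorem mainTheorem1 {E : Type*} [NormedAddCommGroup E] [NormedSpace ℝ E] [CompleteSpace E]
    [Nontrivial E] (S : E → Set (StrongDual ℝ E))
    (hS : Multifunction.IsMaximallyMonotone S) :
    List.TFAE [Multifunction.IsQuasidense S,
      Multifunction.IsTypeFP S,
      Multifunction.IsTypeNI S] := by
  tfae_have 1 → 3 := fun h => h.isTypeNI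
  tfae_have 3 → 1 := fun h => h.isQuasidense hS
  tfae_have 2 → 3 := fun h => h.isTypeNI hS.graph_nonempty
  tfae_have 3 → 2 := fun h => h.isTypeFP hS
  tfae_finish
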